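/- Let $\mathbb{K}$ be a field and let $A$ be a $\mathbb{K}$-algebra that is a semi-commutative skew PBW extension of $\mathbb{K}$ in $x_1,\dots,x_n\in A$. That is: - $\mathbb{K}\subseteq A$, and the standard monomials $x_1^{\alpha_1}\cdots x_n^{\alpha_n}$, $\alpha\in\mathbb{N}^n$, form a basis of $A$ as a left $\mathbb{K}$-module; - (quasi-commutative) for all $i$ and all $r\in\mathbb{K}\setminus\{0\}$ there is $c_{i,r}\in\mathbb{K}\setminus\{0\}$ with $x_i r=c_{i,r}x_i$, and for all $i,j$ there is $c_{i,j}\in\mathbb{K}\setminus\{0\}$ with $x_jx_i=c_{i,j}x_ix_j$; - (constant) the endomorphisms $\sigma_i$ and $\sigma_i$-derivations $\delta_i$ of $\mathbb{K}$ determined by $x_ir=\sigma_i(r)x_i+\delta_i(r)$ satisfy $\sigma_i(r)=r$ and $\delta_i(r)=0$ for all $r\in\mathbb{K}$ and all $i$. Then $A$ is a quantum affine space: there are $q_{ij}\in\mathbb{K}$ with $q_{ii}=1$ and $q_{ij}q_{ji}=1$ such that $A=\mathbb{K}\langle x_1,\dots,x_n\rangle/\langle x_jx_i-q_{ij}x_ix_j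 \mid 1\le i,j\le n\rangle$. Moreover $A$, with the generators $x_1,\dots,x_n$ in degree $1$, is a homogeneous Koszul algebra. That is, $A$ is the quotient of $\mathbb{K}\langle x_1,\dots,x_n\rangle$ by a two-sided ideal generated by elements of the form $\sum_{j,k}c_{j,k}x_jx_k$ with $c_{j,k}\in\mathbb{K}$, and the trivial graded left $A$-module $\mathbb{K}$ (on which every $x_i$ acts by zero) admits a linear free resolution $\cdots\to P_2\to P_1\to P_0\to\mathbb{K}\to 0$, i.e. an exact sequence with degree-preserving $A$-linear maps in which each $P_i$ is a graded free left $A$-module generated in degree $i$. -/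

import Mathlib

namespace SkewPBW

section Extensions

/-- The standard monomial `x^α = x_1^{α_1} ⋯ x_n^{α_n}` (ordered product). -/
def stdMonomial {A : Type*} [Ring A] {n : ℕ} (x : Fin n → A) (α : Fin n → ℕ) : A :=
  (List.ofFn fun i => x i ^ α i).prod

/-- `A`, together with the inclusion `ι : R → A` and the elements `x_1, …, x_n`, is a skew PBW
extension of `R`. -/
structure IsSkewPBWExtension {R A : Type*} [Ring R] [Ring A] (ι : R →+* A) {n : ℕ}
    (x : Fin n → A) : Prop where
  /-- `R ⊆ A`. -/
  injective : Function.Injective ι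
  /-- `A` is a free left `R`-module with basis the standard monomials: every element of `A` is
  `∑_α r_α x^α` for exactly one finitely supported family `(r_α)` of elements of `R`. -/
  basis : Function.Bijective fun f : (Fin n → ℕ) →₀ R =>
    f.sum fun α r => ι r * stdMonomial x α
  /-- `x_i r - c_{i,r} x_i ∈ R`. -/
  var_coeff : ∀ (i : Fin n) (r : R), r ≠ 0 → ∃ c : R, c ≠ 0 ∧
    ∃ s : R, x i * ι r - ι c * x i = ι s
  /-- `x_j x_i - c_{i,j} x_i x_j ∈ R + R x_1 + ⋯ + R x_n`. -/
  var_var : ∀ i j : Fin n, ∃ c : R, c ≠ 0 ∧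
    ∃ (s₀ : R) (s : Fin n → R), x j * x i - ι c * x i * x j = ι s₀ + ∑ k, ι (s k) * x k

/-- Quasi-commutative skew PBW extensions: `x_i r = c_{i,r} x_i` and `x_j x_i = c_{i,j} x_i x_j`
with nonzero `c_{i,r}` (for `r ≠ 0`) and `c_{i,j}`. -/
structure IsQuasiCommutative {R A : Type*} [Ring R] [Ring A] (ι : R →+* A) {n : ℕ}
    (x : Fin n → A) : Prop extends IsSkewPBWExtension ι x where
  var_coeff_eq : ∀ (i : Fin n) (r : R), r ≠ 0 → ∃ c : R, c ≠ 0 ∧ x i * ι r = ι c * x i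
  var_var_eq : ∀ i j : Fin n, ∃ c : R, c ≠ 0 ∧ x j * x i = ι c * x i * x j

/-- `σ_i` are injective endomorphisms of `R` and `δ_i` are `σ_i`-derivations of `R` with
`x_i r = σ_i(r) x_i + δ_i(r)`. In a skew PBW extension these conditions determine `σ` and `δ`,
because `1` and `x_i` are left linearly independent over `R`. -/
structure IsSigmaDelta {R A : Type*} [Ring R] [Ring A] (ι : R →+* A) {n : ℕ} (x : Fin n → A)
    (σ : Fin n → R →+* R) (δ : Fin n → R →+ R) : Prop where
  injective : ∀ i, Function.Injective (σ i)
  leibniz : ∀ i r s, δ i (r * s) = σ i r * δ i s + δ i r * s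
  var_mul : ∀ i r, x i * ι r = ι (σ i r) * x i + ι (δ i r)

/-- Constant: every `r ∈ R` satisfies `σ_i(r) = r` and `δ_i(r) = 0` for all `i`. -/
def IsConstant {R A : Type*} [Ring R] [Ring A] (ι : R →+* A) {n : ℕ} (x : Fin n → A) : Prop :=
  ∃ (σ : Fin n → R →+* R) (δ : Fin n → R →+ R), IsSigmaDelta ι x σ δ ∧
    ∀ r i, σ i r = r ∧ δ i r = 0

/-- Semi-commutative: quasi-commutative and constant. -/
structure IsSemiCommutative {R A : Type*} [Ring R] [Ring A] (ι : R →+* A) {n : ℕ}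
    (x : Fin n → A) : Prop where
  quasiCommutative : IsQuasiCommutative ι x
  constant : IsConstant ι x

end Extensions

section Presentations

variable (K : Type*) [Field K] {A : Type*} [Ring A] [Algebra K A] {n : ℕ}

/-- `A = K⟨X_1, …, X_n⟩ / ⟨Q⟩` with `x_i` the class of `X_i`: the algebra map
`K⟨X_1, …, X_n⟩ → A`, `X_i ↦ x_i`, is surjective, and its kernel is the two-sided ideal
generated by `Q`. -/
def IsPresentedBy (x : Fin n → A) (Q : Set (FreeAlgebra K (Fin n))) : Prop :=
  Function.Surjective (FreeAlgebra.lift K x) ∧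
    TwoSidedIdeal.ker (FreeAlgebra.lift K x) = TwoSidedIdeal.span Q

/-- `A` is the multiparameter quantum affine space on `x_1, …, x_n`: it has the relations
`x_j x_i = q_{ij} x_i x_j`, where `q_{ii} = 1` and `q_{ij} q_{ji} = 1`. -/
def IsQuantumAffineSpace (x : Fin n → A) : Prop :=
  ∃ q : Fin n → Fin n → K, (∀ i, q i i = 1) ∧ (∀ i j, q i j * q j i = 1) ∧
    IsPresentedBy K x {p | ∃ i j, p = FreeAlgebra.ι K j * FreeAlgebra.ι K i -
      q i j • (FreeAlgebra.ι K i * FreeAlgebra.ι K j)}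

/-- `A` is homogeneous pre-Koszul with generators `x_1, …, x_n`: it is the quotient of the free
algebra by an ideal generated by elements `∑ c_{jk} X_j X_k`. -/
def IsHomogeneousPreKoszul (x : Fin n → A) : Prop :=
  ∃ Q : Set (FreeAlgebra K (Fin n)),
    (∀ p ∈ Q, ∃ c : Fin n → Fin n → K,
      p = ∑ j, ∑ k, c j k • (FreeAlgebra.ι K j * FreeAlgebra.ι K k)) ∧
    IsPresentedBy K x Q

/-- The homogeneous component `A_j`: the `K`-span of the products of `j` generators
(`A_0 = K`). -/
def component (x : Fin n → A) (j : ℕ) : Submodule K A :=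
  Submodule.span K (Set.range x) ^ j

/-- The component of degree `j` of the graded free left module `⊕_{s ∈ S} A(-i)`, whose basis
elements all have degree `i`: the vectors with all coordinates in `A_{j-i}`, and `0` if `j < i`. -/
def freeComponent (x : Fin n → A) (S : Type) (i j : ℕ) : Set (S →₀ A) :=
  {f | if i ≤ j then ∀ s, f s ∈ component K x (j - i) else f = 0}

/-- A linear free resolution `⋯ → P_2 → P_1 → P_0 → K → 0` of the trivial graded left
`A`-module `K` (on which each `x_i` acts by zero), where `P_i = ⊕_{s ∈ S_i} A(-i)` is the graded
free left module on generators of degree `i`; all maps are `A`-linear and preserve degrees. Index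
types in `Type` are general enough: the sets `S_i` of such a resolution are necessarily finite,
since `K ⊗_A P_i` is isomorphic to `Tor_i^A(K, K)`, of finite dimension in each degree. -/
structure LinearFreeResolution (x : Fin n → A) where
  /-- The augmentation, through which `A` acts on `K`. -/
  ε : A →ₐ[K] K
  ε_var : ∀ i, ε (x i) = 0
  /-- The basis of `P_i`. -/
  S : ℕ → Type
  /-- The differential `P_{i+1} → P_i`. -/
  d : ∀ i, (S (i + 1) →₀ A) →ₗ[A] (S i →₀ A)
  d_degree : ∀ i j, ∀ f ∈ freeComponent K x (S (i + 1)) (i + 1) j,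
    d i f ∈ freeComponent K x (S i) i j
  /-- The map `P_0 → K`; being `ε`-semilinear means being `A`-linear for the action of `A` on `K`
  through `ε`. -/
  π : (S 0 →₀ A) →ₛₗ[(ε : A →+* K)] K
  /-- `K` is concentrated in degree `0`. -/
  π_degree : ∀ j, 0 < j → ∀ f ∈ freeComponent K x (S 0) 0 j, π f = 0
  π_surjective : Function.Surjective π
  exact_zero : Function.Exact (d 0) π
  exact_succ : ∀ i, Function.Exact (d (i + 1)) (d i)

/-- `A`, with generators `x_1, …, x_n` of degree `1`, is a homogeneous Koszul algebra: it is
homogeneous pre-Koszul and the module `K` admits a linear free resolution. -/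
def IsHomogeneousKoszul (x : Fin n → A) : Prop :=
  IsHomogeneousPreKoszul K x ∧ Nonempty (LinearFreeResolution K x)

end Presentations

end SkewPBW

/-! Up to nonzero scalars the variables commute, so standard monomials multiply like commutative
ones: `stdMonomial_mul`. As they form a basis, no product `x i * x j` vanishes, and applying the
commutation rule twice forces `q i j * q j i = 1`, and once `q i i = 1`. The relations reduce every
noncommutative polynomial to a combination of standard monomials, whose images in `A` are
independent; so they generate all relations.

For Koszulity, the resolution is a twisted Koszul complex, with one generator for each set `T` of
variables. Write x_T for the squarefree monomial with support `T`. Multiplying the coordinate at `T`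
by x_T on the right is injective and absorbs the twisting scalars: it embeds the complex into the
chains of a full simplex with coefficients in `A` (`toSimplex_koszulDiff`), with image the chains
whose value at `T` lies in A x_T.

There a contraction is explicit. Split an element by the first variable of its monomials and insert
that variable into `T`. This preserves the image (`firstVarProj_mem`), and it is a homotopy between
the identity and the projection to constant terms (`boundary_coneOp_add`, `sum_firstVarProj`).
Chains without constant terms therefore bound as soon as they are cycles. -/

namespace SkewPBW

/-! ### Products of standard monomials up to scalars -/

section Monomials

variable (K : Type*) [Field K] {A : Type*} [Ring A] [Algebra K A] {n : ℕ}

/-- Equality up to a nonzero scalar. -/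
def scalarCon (A : Type*) [Ring A] [Algebra K A] : Con A where
  r a b := ∃ c : K, c ≠ 0 ∧ a = c • b
  iseqv := by
    refine ⟨fun a => ⟨1, one_ne_zero, (one_smul K a).symm⟩, ?_, ?_⟩
    · rintro a b ⟨c, hc, rfl⟩
      exact ⟨c⁻¹, inv_ne_zero hc, (inv_smul_smul₀ hc b).symm⟩
    · rintro a b d ⟨c, hc, rfl⟩ ⟨c', hc', rfl⟩
      exact ⟨c * c', mul_ne_zero hc hc', smul_smul c c' d⟩
  mul' := by
    rintro a b d e ⟨c, hc, rfl⟩ ⟨c', hc', rfl⟩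
    exact ⟨c * c', mul_ne_zero hc hc', smul_mul_smul_comm c b c' e⟩

theorem stdMonomial_add_of_commute {M : Type*} [Monoid M] (y : Fin n → M)
    (hy : ∀ i j, y i * y j = y j * y i) (α β : Fin n → ℕ) :
    (List.ofFn fun i => y i ^ α i).prod * (List.ofFn fun i => y i ^ β i).prod =
      (List.ofFn fun i => y i ^ (α i + β i)).prod := by
  have hcomm : ∀ a ∈ Set.range y, ∀ b ∈ Set.range y, a * b = b * a := by
    rintro _ ⟨i, rfl⟩ _ ⟨j, rfl⟩
    exact hy i j
  have := Submonoid.isMulCommutative_closure M hcomm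
  -- The submonoid generated by the `y i` is commutative, so ordered products become `Finset`
  -- products there.
  let _ : CommMonoid (Submonoid.closure (Set.range y)) :=
    { (inferInstance : Monoid (Submonoid.closure (Set.range y))) with
      mul_comm := fun a b => IsMulCommutative.is_comm.comm a b }
  let y' : Fin n → Submonoid.closure (Set.range y) :=
    fun i => ⟨y i, Submonoid.subset_closure ⟨i, rfl⟩⟩
  have key : ∀ γ : Fin n → ℕ, (List.ofFn fun i => y i ^ γ i).prod =
      ((List.ofFn fun i => y' i ^ γ i).prod : Submonoid.closure (Set.range y)) := by
    intro γ
    rw [Submonoid.coe_list_prod, List.map_ofFn]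
    rfl
  rw [key, key, key, ← Submonoid.coe_mul]
  congr 1
  rw [List.prod_ofFn, List.prod_ofFn, List.prod_ofFn, ← Finset.prod_mul_distrib]
  exact Finset.prod_congr rfl fun i _ => (pow_add _ _ _).symm

/-- Modulo `scalarCon` the variables commute; an equality in that quotient is an equality up to a
nonzero scalar. -/
theorem stdMonomial_mul (x : Fin n → A)
    (hx : ∀ i j, ∃ c : K, c ≠ 0 ∧ x j * x i = c • (x i * x j)) (α β : Fin n → ℕ) :
    ∃ c : K, c ≠ 0 ∧ stdMonomial x α * stdMonomial x β = c • stdMonomial x (α + β) := by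
  have hcoe : ∀ γ : Fin n → ℕ, ((stdMonomial x γ : A) : (scalarCon K A).Quotient) =
      (List.ofFn fun i => (x i : (scalarCon K A).Quotient) ^ γ i).prod := by
    intro γ
    change (scalarCon K A).mk' _ = _
    rw [stdMonomial, map_list_prod, List.map_ofFn]
    rfl
  have h := stdMonomial_add_of_commute (fun i => (x i : (scalarCon K A).Quotient))
    (fun i j => by
      rw [← Con.coe_mul, ← Con.coe_mul, Con.eq]
      exact hx j i) α β
  rw [← hcoe, ← hcoe, ← Con.coe_mul] at h
  have h' := h.trans (hcoe (α + β)).symm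
  rwa [Con.eq] at h'

theorem stdMonomial_zero (x : Fin n → A) : stdMonomial x 0 = 1 := by
  simp [stdMonomial]

theorem stdMonomial_single (x : Fin n → A) (i : Fin n) :
    stdMonomial x (Pi.single i 1) = x i := by
  induction n with
  | zero => exact i.elim0
  | succ n ih =>
    rw [stdMonomial, List.ofFn_succ, List.prod_cons]
    refine Fin.cases ?_ (fun j => ?_) i
    · simp [Fin.succ_ne_zero]
    · have := ih (fun k => x k.succ) j
      rw [stdMonomial] at this
      simpa [Pi.single_apply, (Fin.succ_ne_zero j).symm] using this

theorem map_stdMonomial {B : Type*} [Ring B] (φ : A →+* B) (x : Fin n → A) (α : Fin n → ℕ) :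
    φ (stdMonomial x α) = stdMonomial (fun i => φ (x i)) α := by
  rw [stdMonomial, map_list_prod, List.map_ofFn, stdMonomial]
  congr 2
  funext i
  simp

end Monomials

/-! ### Presentation by quantum relations -/

section Presentation

variable (K : Type*) [Field K] {A : Type*} [Ring A] [Algebra K A] {n : ℕ}

/-- The defining relations of a multiparameter quantum affine space. -/
abbrev quantumRelations (q : Fin n → Fin n → K) : Set (FreeAlgebra K (Fin n)) :=
  {p | ∃ i j, p = FreeAlgebra.ι K j * FreeAlgebra.ι K i -
    q i j • (FreeAlgebra.ι K i * FreeAlgebra.ι K j)}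

/-- In the quotient by the relations, the span of the standard monomials contains 1 and the
generators and is closed under products, so it is everything. -/
theorem exists_sub_mem_span_quantumRelations (q : Fin n → Fin n → K) (hq : ∀ i j, q i j ≠ 0)
    (p : FreeAlgebra K (Fin n)) :
    ∃ f : (Fin n → ℕ) →₀ K, p - f.sum (fun α r => r • stdMonomial (FreeAlgebra.ι K) α) ∈
      TwoSidedIdeal.span (quantumRelations K q) := by
  set I := TwoSidedIdeal.span (quantumRelations K q)
  let mk : FreeAlgebra K (Fin n) →ₐ[K] I.ringCon.Quotient := I.ringCon.mkₐ K
  have mk_eq : ∀ a b, mk a = mk b ↔ a - b ∈ I := fun a b => by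
    rw [← TwoSidedIdeal.rel_iff]
    exact RingCon.eq _
  let y : Fin n → I.ringCon.Quotient := fun i => mk (FreeAlgebra.ι K i)
  have hy : ∀ i j, ∃ c : K, c ≠ 0 ∧ y j * y i = c • (y i * y j) := fun i j => by
    refine ⟨q i j, hq i j, ?_⟩
    simp only [y]
    rw [← map_mul, ← map_mul, ← map_smul, mk_eq]
    exact TwoSidedIdeal.subset_span ⟨i, j, rfl⟩
  let N : Submodule K I.ringCon.Quotient := Submodule.span K (Set.range (stdMonomial y))
  have hN : ∀ α, stdMonomial y α ∈ N := fun α => Submodule.subset_span ⟨α, rfl⟩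
  have hone : (1 : I.ringCon.Quotient) ∈ N := stdMonomial_zero y ▸ hN 0
  have hmul : N * N ≤ N := by
    rw [Submodule.span_mul_span, Submodule.span_le]
    rintro _ ⟨_, ⟨α, rfl⟩, _, ⟨β, rfl⟩, rfl⟩
    obtain ⟨c, -, hc⟩ := stdMonomial_mul K y hy α β
    simp only [hc]
    exact N.smul_mem _ (hN _)
  have hp : mk p ∈ N := by
    induction p using FreeAlgebra.induction with
    | grade0 r =>
      rw [AlgHom.commutes, Algebra.algebraMap_eq_smul_one]
      exact N.smul_mem _ hone
    | grade1 i =>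
      have h := hN (Pi.single i 1)
      rwa [stdMonomial_single] at h
    | mul a b ha hb =>
      rw [map_mul]
      exact hmul (Submodule.mul_mem_mul ha hb)
    | add a b ha hb =>
      rw [map_add]
      exact N.add_mem ha hb
  obtain ⟨f, hf⟩ := Finsupp.mem_span_range_iff_exists_finsupp.1 hp
  refine ⟨f, (mk_eq _ _).1 ?_⟩
  rw [← hf, map_finsuppSum]
  refine Finsupp.sum_congr fun α _ => ?_
  rw [map_smul]
  congr 1
  exact (map_stdMonomial mk.toRingHom _ α).symm

theorem isPresentedBy_quantumRelations (x : Fin n → A) (q : Fin n → Fin n → K)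
    (hq : ∀ i j, q i j ≠ 0) (hx : ∀ i j, x j * x i = q i j • (x i * x j))
    (b : Module.Basis (Fin n → ℕ) K A) (hb : ∀ α, b α = stdMonomial x α) :
    IsPresentedBy K x (quantumRelations K q) := by
  have hlift : ∀ f : (Fin n → ℕ) →₀ K, FreeAlgebra.lift K x
      (f.sum fun α r => r • stdMonomial (FreeAlgebra.ι K) α) =
        f.sum fun α r => r • b α := by
    intro f
    rw [map_finsuppSum]
    refine Finsupp.sum_congr fun α _ => ?_
    rw [map_smul, hb]
    congr 1
    refine (map_stdMonomial (FreeAlgebra.lift K x : FreeAlgebra K (Fin n) →+* A) _ α).trans ?_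
    simp
  have hle : TwoSidedIdeal.span (quantumRelations K q) ≤
      TwoSidedIdeal.ker (FreeAlgebra.lift K x) := by
    rw [TwoSidedIdeal.span_le]
    rintro _ ⟨i, j, rfl⟩
    simp [TwoSidedIdeal.mem_ker, hx i j]
  refine ⟨fun a => ⟨_, (hlift (b.repr a)).trans (b.linearCombination_repr a)⟩,
    le_antisymm (fun p hp => ?_) hle⟩
  -- The normal form of a kernel element maps to zero in `A`, so independence of the monomials makes
  -- it zero.
  obtain ⟨f, hf⟩ := exists_sub_mem_span_quantumRelations K q hq p
  have hz := (TwoSidedIdeal.mem_ker _).1 (hle hf)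
  rw [map_sub, (TwoSidedIdeal.mem_ker _).1 hp, zero_sub, neg_eq_zero, hlift] at hz
  have hf0 : f = 0 := (linearIndependent_iff.1 b.linearIndependent) f hz
  simpa [hf0] using hf

theorem isHomogeneousPreKoszul_of_isQuantumAffineSpace {x : Fin n → A}
    (h : IsQuantumAffineSpace K x) : IsHomogeneousPreKoszul K x := by
  obtain ⟨q, -, -, hp⟩ := h
  refine ⟨_, ?_, hp⟩
  rintro _ ⟨i, j, rfl⟩
  -- A difference of indicators also covers `i = j`, where both fall on the same coefficient.
  refine ⟨fun k l => (if k = j ∧ l = i then 1 else 0) - if k = i ∧ l = j then q i j else 0, ?_⟩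
  simp [sub_smul, Finset.sum_sub_distrib, ite_and, ite_smul]

end Presentation

/-! ### The standard basis and the quantum parameters -/

section Basis

variable {K : Type*} [Field K] {A : Type*} [Ring A] [Algebra K A] {n : ℕ} {x : Fin n → A}

theorem IsSkewPBWExtension.exists_basis (h : IsSkewPBWExtension (algebraMap K A) x) :
    ∃ b : Module.Basis (Fin n → ℕ) K A, ∀ α, b α = stdMonomial x α := by
  have hbij : Function.Bijective (Finsupp.linearCombination K (stdMonomial x)) := by
    convert h.basis using 2 with f
    simp [Finsupp.linearCombination_apply, Algebra.smul_def]
  refine ⟨.ofRepr (LinearEquiv.ofBijective _ hbij).symm, fun α => ?_⟩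
  simp

theorem IsQuasiCommutative.exists_quantum_parameters
    (h : IsQuasiCommutative (algebraMap K A) x) :
    ∃ q : Fin n → Fin n → K, (∀ i, q i i = 1) ∧ (∀ i j, q i j * q j i = 1) ∧
      ∀ i j, x j * x i = q i j • (x i * x j) := by
  choose q hq hx using h.var_var_eq
  replace hx : ∀ i j, x j * x i = q i j • (x i * x j) := fun i j => by
    rw [hx i j, mul_assoc, Algebra.smul_def]
  obtain ⟨b, hb⟩ := h.exists_basis
  have hne : ∀ i j, x i * x j ≠ 0 := fun i j h0 => by
    obtain ⟨c, hc, he⟩ := stdMonomial_mul K x (fun i j => ⟨q i j, hq i j, hx i j⟩)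
      (Pi.single i 1) (Pi.single j 1)
    rw [stdMonomial_single, stdMonomial_single, h0, ← hb] at he
    exact (smul_ne_zero hc (b.ne_zero _)) he.symm
  have hmul : ∀ i j, q i j * q j i = 1 := fun i j => by
    have h1 := hx i j
    rw [hx j i, smul_smul] at h1
    have h2 : (1 - q i j * q j i) • (x j * x i) = 0 := by
      rw [sub_smul, one_smul, ← h1, sub_self]
    exact (sub_eq_zero.1 ((smul_eq_zero.1 h2).resolve_right (hne j i))).symm
  refine ⟨q, fun i => ?_, hmul, hx⟩
  have h2 : (1 - q i i) • (x i * x i) = 0 := by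
    rw [sub_smul, one_smul, ← hx i i, sub_self]
  exact (sub_eq_zero.1 ((smul_eq_zero.1 h2).resolve_right (hne i i))).symm

end Basis


/-! ### Chains on a simplex and the cone homotopy -/

section SimplexBoundary

variable {n : ℕ} {M : Type*} [AddCommGroup M]

/-- The sign of the position of `s` relative to `T`. -/
def posSign (s : Fin n) (T : Finset (Fin n)) : ℤ := (-1) ^ (T.filter (· < s)).card

theorem posSign_mul_self (s : Fin n) (T : Finset (Fin n)) :
    posSign s T * posSign s T = 1 := by
  rw [posSign, ← mul_pow]
  simp

theorem posSign_insert_of_lt {r s : Fin n} {T : Finset (Fin n)} (hs : s ∉ T) (h : s < r) :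
    posSign r (insert s T) = -posSign r T := by
  rw [posSign, Finset.filter_insert, if_pos h, Finset.card_insert_of_notMem (by simp [hs]),
    pow_succ, posSign, mul_neg_one]

theorem posSign_insert_of_not_lt {r s : Fin n} {T : Finset (Fin n)} (h : ¬ s < r) :
    posSign r (insert s T) = posSign r T := by
  rw [posSign, Finset.filter_insert, if_neg h, posSign]

/-- Inserting the smaller vertex flips the sign of the larger one, but not conversely; so the two
orders of insertion differ by one sign. -/
theorem posSign_anticomm {r s : Fin n} {T : Finset (Fin n)} (hr : r ∉ T) (hs : s ∉ T)
    (hrs : r ≠ s) :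
    posSign s T * posSign r (insert s T) + posSign r T * posSign s (insert r T) = 0 := by
  rcases lt_or_gt_of_ne hrs with h | h
  · rw [posSign_insert_of_not_lt h.not_gt, posSign_insert_of_lt hr h]
    ring
  · rw [posSign_insert_of_not_lt h.not_gt, posSign_insert_of_lt hs h]
    ring

theorem posSign_insert_self (s : Fin n) (T : Finset (Fin n)) :
    posSign s (insert s T) = posSign s T :=
  posSign_insert_of_not_lt (lt_irrefl s)

/-- The boundary operator of the full simplex, with coefficients in `M`. -/
def boundary (g : Finset (Fin n) → M) (T : Finset (Fin n)) : M :=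
  ∑ s ∈ Tᶜ, posSign s T • g (insert s T)

/-- The operator inserting a vertex `i` after applying the `i`-th of a family of
endomorphisms. -/
def coneOp (p : Fin n → M →+ M) (g : Finset (Fin n) → M) (T : Finset (Fin n)) : M :=
  ∑ i ∈ T, posSign i T • p i (g (T.erase i))

theorem boundary_boundary (g : Finset (Fin n) → M) : boundary (boundary g) = 0 := by
  funext T
  simp only [boundary, Finset.smul_sum, Pi.zero_apply, smul_smul]
  rw [Finset.sum_sigma']
  -- Pairs of inserted vertices cancel against the same pairs in the other order.
  refine Finset.sum_involution (fun a _ => ⟨a.2, a.1⟩) ?_ ?_ ?_ ?_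
  · rintro ⟨s, r⟩ h
    simp only [Finset.mem_sigma, Finset.mem_compl, Finset.mem_insert, not_or] at h
    rw [Finset.insert_comm r s, ← add_smul, posSign_anticomm h.2.2 h.1 h.2.1, zero_smul]
  · rintro ⟨s, r⟩ h - he
    simp only [Finset.mem_sigma, Finset.mem_compl, Finset.mem_insert, not_or] at h
    exact h.2.1 (congrArg Sigma.fst he)
  · rintro ⟨s, r⟩ h
    simp only [Finset.mem_sigma, Finset.mem_compl, Finset.mem_insert, not_or] at h ⊢
    exact ⟨h.2.2, fun e => h.2.1 e.symm, h.1⟩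
  · rintro ⟨s, r⟩ h
    rfl

/-- The diagonal terms of the first summand give `p s (g T)` for `s ∉ T`, those of the second for `s
∈ T`. All remaining terms belong to pairs `s ∉ T`, `i ∈ T` and cancel by signs. -/
theorem boundary_coneOp_add (p : Fin n → M →+ M) (g : Finset (Fin n) → M)
    (T : Finset (Fin n)) :
    boundary (coneOp p g) T + coneOp p (boundary g) T = ∑ i, p i (g T) := by
  have h1 : boundary (coneOp p g) T = ∑ s ∈ Tᶜ, p s (g T) + ∑ s ∈ Tᶜ, ∑ i ∈ T,
      (posSign s T * posSign i (insert s T)) • p i (g (insert s (T.erase i))) := by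
    rw [boundary, ← Finset.sum_add_distrib]
    refine Finset.sum_congr rfl fun s hs => ?_
    have hs := Finset.mem_compl.1 hs
    rw [coneOp, Finset.sum_insert hs, smul_add, smul_smul, Finset.erase_insert hs,
      posSign_insert_self, posSign_mul_self, one_smul, Finset.smul_sum]
    congr 1
    refine Finset.sum_congr rfl fun i hi => ?_
    rw [smul_smul, Finset.erase_insert_of_ne (by rintro rfl; exact hs hi)]
  have h2 : coneOp p (boundary g) T = ∑ i ∈ T, p i (g T) + ∑ s ∈ Tᶜ, ∑ i ∈ T,
      (posSign i T * posSign s (T.erase i)) • p i (g (insert s (T.erase i))) := by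
    rw [coneOp, Finset.sum_comm, ← Finset.sum_add_distrib]
    refine Finset.sum_congr rfl fun i hi => ?_
    have hT : posSign i T = posSign i (T.erase i) := by
      conv_lhs => rw [← Finset.insert_erase hi, posSign_insert_self]
    rw [boundary, Finset.compl_erase, Finset.sum_insert (by simpa using hi),
      Finset.insert_erase hi, map_add, smul_add, map_zsmul, smul_smul, ← hT,
      posSign_mul_self, one_smul, map_sum, Finset.smul_sum]
    congr 1
    refine Finset.sum_congr rfl fun s hs => ?_
    rw [map_zsmul, smul_smul]
  have h3 : ∀ s ∈ Tᶜ, ∀ i ∈ T,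
      (posSign s T * posSign i (insert s T)) • p i (g (insert s (T.erase i))) +
      (posSign i T * posSign s (T.erase i)) • p i (g (insert s (T.erase i))) = 0 := by
    intro s hs i hi
    have hs := Finset.mem_compl.1 hs
    have hsi : s ≠ i := fun e => hs (e ▸ hi)
    obtain ⟨U, hU, rfl⟩ : ∃ U, i ∉ U ∧ T = insert i U :=
      ⟨T.erase i, by simp, (Finset.insert_erase hi).symm⟩
    have hsU : s ∉ U := fun h => hs (Finset.mem_insert_of_mem h)
    rw [Finset.erase_insert hU, ← add_smul, posSign_insert_self, Finset.insert_comm,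
      posSign_insert_self]
    have hz : posSign s (insert i U) * posSign i (insert s U) +
        posSign i U * posSign s U = 0 := by
      rcases lt_or_gt_of_ne hsi with h | h
      · rw [posSign_insert_of_not_lt h.not_gt, posSign_insert_of_lt hsU h]
        ring
      · rw [posSign_insert_of_not_lt h.not_gt, posSign_insert_of_lt hU h]
        ring
    rw [hz, zero_smul]
  rw [h1, h2, add_add_add_comm, ← Finset.sum_add_distrib,
    Finset.sum_eq_zero (s := Tᶜ) (f := fun s => _ + _) fun s hs => ?_, add_zero, add_comm,
    Finset.sum_add_sum_compl]
  rw [← Finset.sum_add_distrib]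
  exact Finset.sum_eq_zero fun i hi => h3 s hs i hi

end SimplexBoundary


/-! ### Monomial bases, divisibility and augmentation -/

section MonomialBasis

variable {K : Type*} [Field K] {A : Type*} [Ring A] [Algebra K A] {n : ℕ}

/-- A basis indexed by exponents which multiplies like monomials, up to nonzero scalars. -/
structure IsMonomialBasis (b : Module.Basis (Fin n → ℕ) K A) : Prop where
  one : b 0 = 1
  mul : ∀ α β, ∃ c : K, c ≠ 0 ∧ b α * b β = c • b (α + β)

/-- The exponent of the squarefree monomial with support `T`. -/
def indicatorExp (T : Finset (Fin n)) : Fin n → ℕ := fun i => if i ∈ T then 1 else 0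

theorem indicatorExp_insert {s : Fin n} {T : Finset (Fin n)} (hs : s ∉ T) :
    Pi.single s 1 + indicatorExp T = indicatorExp (insert s T) := by
  funext i
  by_cases h : i = s
  · subst h
    simp [indicatorExp, hs]
  · simp [indicatorExp, h]

/-- The left multiples of the squarefree monomial with support `T`. -/
noncomputable def leftMultiples (b : Module.Basis (Fin n → ℕ) K A) (T : Finset (Fin n)) : Submodule K A :=
  LinearMap.range (LinearMap.mulRight K (b (indicatorExp T)))

/-- The projection onto the span of the monomials whose first variable is the `i`-th one. -/
noncomputable def firstVarProj (b : Module.Basis (Fin n → ℕ) K A) (i : Fin n) : A →ₗ[K] A :=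
  b.constr K fun β => if β i ≠ 0 ∧ ∀ j < i, β j = 0 then b β else 0

variable {b : Module.Basis (Fin n → ℕ) K A}

/-- Every monomial other than 1 has exactly one first variable, and 1 has none. -/
theorem sum_firstVarProj (hb : IsMonomialBasis b) (a : A) :
    ∑ i, firstVarProj b i a = a - algebraMap K A (b.coord 0 a) := by
  have h : ∑ i, firstVarProj b i = LinearMap.id - (b.coord 0).smulRight 1 := by
    refine b.ext fun β => ?_
    simp only [firstVarProj, LinearMap.sum_apply, Module.Basis.constr_basis, LinearMap.sub_apply,
      LinearMap.id_apply, LinearMap.smulRight_apply, Module.Basis.coord_apply,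
      Module.Basis.repr_self]
    by_cases hβ : β = 0
    · subst hβ
      simp [hb.one]
    · obtain ⟨i₀, hi₀⟩ := Function.ne_iff.1 hβ
      obtain ⟨i, hi, hmin⟩ := wellFounded_lt.has_min {i | β i ≠ 0} ⟨i₀, hi₀⟩
      have hlt : ∀ j < i, β j = 0 := fun j hj => by
        by_contra h
        exact hmin j h hj
      rw [Finset.sum_eq_single i, if_pos ⟨hi, hlt⟩, Finsupp.single_eq_of_ne (Ne.symm hβ),
        zero_smul, sub_zero]
      · intro j _ hj
        refine if_neg fun h => ?_
        rcases lt_or_gt_of_ne hj with h' | h'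
        · exact h.1 (hlt j h')
        · exact hi (h.2 i h')
      · simp
  have h' := LinearMap.congr_fun h a
  simpa [Algebra.algebraMap_eq_smul_one] using h'

theorem IsMonomialBasis.mem_leftMultiples (hb : IsMonomialBasis b) {T : Finset (Fin n)}
    {β : Fin n → ℕ} (h : ∀ i ∈ T, β i ≠ 0) : b β ∈ leftMultiples b T := by
  obtain ⟨c, hc, he⟩ := hb.mul (β - indicatorExp T) (indicatorExp T)
  rw [tsub_add_cancel_of_le] at he
  · refine ⟨c⁻¹ • b (β - indicatorExp T), ?_⟩
    rw [LinearMap.mulRight_apply, smul_mul_assoc, he, inv_smul_smul₀ hc]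
  · intro i
    unfold indicatorExp
    split_ifs with hi
    · exact Nat.one_le_iff_ne_zero.2 (h i hi)
    · exact Nat.zero_le _

/-- A monomial divisible by all variables in `T` is either killed, or kept because the `i`-th
variable occurs in it too. This lets the cone homotopy restrict to the Koszul complex. -/
theorem IsMonomialBasis.firstVarProj_mem (hb : IsMonomialBasis b) (i : Fin n)
    {T : Finset (Fin n)} {a : A} (ha : a ∈ leftMultiples b T) :
    firstVarProj b i a ∈ leftMultiples b (insert i T) := by
  obtain ⟨a, rfl⟩ := ha
  have h : ⊤ ≤ (leftMultiples b (insert i T)).comap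
      (firstVarProj b i ∘ₗ LinearMap.mulRight K (b (indicatorExp T))) := by
    rw [← b.span_eq, Submodule.span_le]
    rintro _ ⟨α, rfl⟩
    obtain ⟨c, -, hc⟩ := hb.mul α (indicatorExp T)
    simp only [SetLike.mem_coe, Submodule.mem_comap, LinearMap.comp_apply,
      LinearMap.mulRight_apply, hc, map_smul]
    refine Submodule.smul_mem _ _ ?_
    rw [firstVarProj, Module.Basis.constr_basis]
    split_ifs with hi
    · refine hb.mem_leftMultiples fun j hj => ?_
      rcases Finset.mem_insert.1 hj with rfl | hj
      · exact hi.1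
      · simp [indicatorExp, hj]
    · exact Submodule.zero_mem _
  exact h (Submodule.mem_top (x := a))

theorem IsMonomialBasis.mul_right_injective (hb : IsMonomialBasis b) (γ : Fin n → ℕ) :
    Function.Injective fun a => a * b γ := by
  choose c hc hmul using fun α => hb.mul α γ
  -- A left inverse shifts exponents back by `γ`; truncated subtraction is harmless, since only
  -- exponents `α + γ` occur.
  have h : b.constr K (fun β => (c (β - γ))⁻¹ • b (β - γ)) ∘ₗ LinearMap.mulRight K (b γ) =
      LinearMap.id := by
    refine b.ext fun α => ?_
    simp [hmul, smul_smul, mul_inv_cancel₀ (hc α)]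
  intro a a' haa
  have h' := congrArg (b.constr K fun β => (c (β - γ))⁻¹ • b (β - γ)) haa
  exact (LinearMap.congr_fun h a).symm.trans (h'.trans (LinearMap.congr_fun h a'))

/-- The augmentation: the coefficient of the monomial `1`. -/
noncomputable def IsMonomialBasis.augmentation (hb : IsMonomialBasis b) : A →ₐ[K] K :=
  AlgHom.ofLinearMap (b.coord 0) (by simp [← hb.one]) <| by
    rw [LinearMap.map_mul_iff]
    refine b.ext fun α => b.ext fun β => ?_
    simp only [LinearMap.compr₂_apply, LinearMap.mul_apply', LinearMap.compl₂_apply,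
      LinearMap.comp_apply]
    obtain ⟨c, -, hc⟩ := hb.mul α β
    by_cases hα : α = 0
    · subst hα
      rw [hb.one, one_mul, ← hb.one]
      simp
    · have h : α + β ≠ 0 := fun h => hα (add_eq_zero.1 h).1
      rw [hc]
      simp [Finsupp.single_eq_of_ne (Ne.symm hα), Finsupp.single_eq_of_ne (Ne.symm h)]

theorem IsMonomialBasis.augmentation_apply (hb : IsMonomialBasis b) (a : A) :
    hb.augmentation a = b.coord 0 a := rfl

theorem IsMonomialBasis.augmentation_basis (hb : IsMonomialBasis b) {α : Fin n → ℕ}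
    (hα : α ≠ 0) : hb.augmentation (b α) = 0 := by
  rw [hb.augmentation_apply, b.coord_apply, b.repr_self, Finsupp.single_eq_of_ne (Ne.symm hα)]

end MonomialBasis

/-! ### The twisted Koszul resolution -/

section KoszulComplex

variable {K : Type*} [Field K] {A : Type*} [Ring A] [Algebra K A] {n : ℕ}

/-- The subsets of size `i` of the set of variables. -/
abbrev Face (n i : ℕ) : Type := {T : Finset (Fin n) // T.card = i}

/-- The face obtained by adding a vertex. -/
def Face.cons {i : ℕ} (T : Face n i) (s : {s // s ∉ T.1}) : Face n (i + 1) :=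
  ⟨insert s.1 T.1, by rw [Finset.card_insert_of_notMem s.2, T.2]⟩

/-- The differential of the Koszul complex twisted by the scalars `c`. -/
noncomputable def koszulDiff (x : Fin n → A) (c : Fin n → Finset (Fin n) → K) (i : ℕ) :
    (Face n (i + 1) →₀ A) →ₗ[A] (Face n i →₀ A) :=
  (Finsupp.linearEquivFunOnFinite A A (Face n i)).symm.toLinearMap ∘ₗ
    LinearMap.pi fun T => ∑ s : {s // s ∉ T.1},
      LinearMap.toSpanSingleton A A (posSign s.1 T.1 • c s.1 T.1 • x s.1) ∘ₗ
        Finsupp.lapply (T.cons s)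

theorem koszulDiff_apply (x : Fin n → A) (c : Fin n → Finset (Fin n) → K) (i : ℕ)
    (f : Face n (i + 1) →₀ A) (T : Face n i) :
    koszulDiff x c i f T =
      ∑ s : {s // s ∉ T.1}, f (T.cons s) * (posSign s.1 T.1 • c s.1 T.1 • x s.1) := by
  simp [koszulDiff]

/-- The embedding of the `i`-th term of the Koszul complex into the chains of a simplex, which
multiplies the coordinate at `T` with the squarefree monomial with support `T`. -/
noncomputable def toSimplex (b : Module.Basis (Fin n → ℕ) K A) {i : ℕ} (f : Face n i →₀ A)
    (T : Finset (Fin n)) : A :=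
  if h : T.card = i then f ⟨T, h⟩ * b (indicatorExp T) else 0

theorem toSimplex_face (b : Module.Basis (Fin n → ℕ) K A) {i : ℕ} (f : Face n i →₀ A)
    (T : Face n i) : toSimplex b f T.1 = f T * b (indicatorExp T.1) := by
  rw [toSimplex, dif_pos T.2]

theorem toSimplex_of_card_ne (b : Module.Basis (Fin n → ℕ) K A) {i : ℕ} (f : Face n i →₀ A)
    {T : Finset (Fin n)} (h : T.card ≠ i) : toSimplex b f T = 0 := by
  rw [toSimplex, dif_neg h]

theorem toSimplex_mem (b : Module.Basis (Fin n → ℕ) K A) {i : ℕ} (f : Face n i →₀ A)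
    (T : Finset (Fin n)) : toSimplex b f T ∈ leftMultiples b T := by
  unfold toSimplex
  split_ifs with h
  · exact ⟨_, rfl⟩
  · exact Submodule.zero_mem _

theorem toSimplex_zero (b : Module.Basis (Fin n → ℕ) K A) {i : ℕ} :
    toSimplex b (0 : Face n i →₀ A) = 0 := by
  funext T
  simp [toSimplex]

variable {b : Module.Basis (Fin n → ℕ) K A} {x : Fin n → A} {c : Fin n → Finset (Fin n) → K}

theorem IsMonomialBasis.toSimplex_injective (hb : IsMonomialBasis b) {i : ℕ} :
    Function.Injective (toSimplex b (i := i)) := by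
  intro f g h
  ext T
  apply hb.mul_right_injective (indicatorExp T.1)
  simpa only [toSimplex_face] using congrFun h T.1

theorem exists_toSimplex_eq {i : ℕ} {g : Finset (Fin n) → A}
    (hmem : ∀ T, T.card = i → g T ∈ leftMultiples b T) (hzero : ∀ T, T.card ≠ i → g T = 0) :
    ∃ f : Face n i →₀ A, toSimplex b f = g := by
  choose a ha using hmem
  refine ⟨Finsupp.equivFunOnFinite.symm fun T => a T.1 T.2, funext fun T => ?_⟩
  by_cases h : T.card = i
  · rw [toSimplex, dif_pos h]
    exact ha T h
  · rw [toSimplex, dif_neg h, hzero T h]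

/-- The condition on `c` says that the scalars undo the reordering of a variable into a squarefree
monomial, so only the simplicial signs remain. -/
theorem toSimplex_koszulDiff
    (hc : ∀ s T, s ∉ T → c s T • (x s * b (indicatorExp T)) = b (indicatorExp (insert s T)))
    {i : ℕ} (f : Face n (i + 1) →₀ A) :
    toSimplex b (koszulDiff x c i f) = boundary (toSimplex b f) := by
  funext T
  by_cases h : T.card = i
  · obtain ⟨T, rfl⟩ : ∃ T' : Face n i, T'.1 = T := ⟨⟨T, h⟩, rfl⟩
    rw [toSimplex_face, koszulDiff_apply, boundary, Finset.sum_mul,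
      Finset.sum_subtype T.1ᶜ (fun s => Finset.mem_compl)]
    refine Finset.sum_congr rfl fun s _ => ?_
    have hs : toSimplex b f (insert s.1 T.1) =
        f (T.cons s) * b (indicatorExp (insert s.1 T.1)) := toSimplex_face b f (T.cons s)
    rw [hs, mul_assoc, smul_mul_assoc, smul_mul_assoc, hc s.1 T.1 s.2, mul_smul_comm]
  · rw [toSimplex_of_card_ne b _ h, boundary, Finset.sum_eq_zero]
    intro s hs
    rw [toSimplex_of_card_ne, smul_zero]
    rw [Finset.card_insert_of_notMem (Finset.mem_compl.1 hs)]
    omega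

theorem IsMonomialBasis.exists_toSimplex_eq_coneOp (hb : IsMonomialBasis b) {i : ℕ}
    (f : Face n i →₀ A) : ∃ f' : Face n (i + 1) →₀ A, toSimplex b f' =
      coneOp (fun k => (firstVarProj b k).toAddMonoidHom) (toSimplex b f) := by
  refine exists_toSimplex_eq (fun T _ => ?_) fun T hT => ?_
  · refine Submodule.sum_mem _ fun k hk => ?_
    refine zsmul_mem ?_ _
    conv => arg 1; rw [← Finset.insert_erase hk]
    exact hb.firstVarProj_mem k (toSimplex_mem b f _)
  · refine Finset.sum_eq_zero fun k hk => ?_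
    rw [toSimplex_of_card_ne, map_zero, smul_zero]
    have := Finset.card_erase_add_one hk
    omega

/-- For a cycle without constant terms the homotopy formula reads: the boundary of its cone is the
cycle itself. The cone comes from the Koszul complex, and `toSimplex` is injective. -/
theorem IsMonomialBasis.exists_koszulDiff_eq (hb : IsMonomialBasis b)
    (hc : ∀ s T, s ∉ T → c s T • (x s * b (indicatorExp T)) = b (indicatorExp (insert s T)))
    {i : ℕ} (f : Face n i →₀ A) (hf : boundary (toSimplex b f) = 0)
    (hε : ∀ T, b.coord 0 (toSimplex b f T) = 0) :
    ∃ f' : Face n (i + 1) →₀ A, koszulDiff x c i f' = f := by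
  obtain ⟨f', hf'⟩ := hb.exists_toSimplex_eq_coneOp f
  refine ⟨f', hb.toSimplex_injective ?_⟩
  rw [toSimplex_koszulDiff hc, hf']
  funext T
  have h := boundary_coneOp_add (fun k => (firstVarProj b k).toAddMonoidHom) (toSimplex b f) T
  rw [hf] at h
  have h0 : coneOp (fun k => (firstVarProj b k).toAddMonoidHom) (0 : Finset (Fin n) → A) T = 0 :=
    Finset.sum_eq_zero fun k _ => by simp
  rw [h0, add_zero] at h
  rw [h]
  refine (sum_firstVarProj hb _).trans ?_
  rw [hε, map_zero, sub_zero]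

theorem IsMonomialBasis.koszulDiff_exact (hb : IsMonomialBasis b)
    (hc : ∀ s T, s ∉ T → c s T • (x s * b (indicatorExp T)) = b (indicatorExp (insert s T)))
    (i : ℕ) : Function.Exact (koszulDiff x c (i + 1)) (koszulDiff x c i) := by
  intro f
  constructor
  · intro h
    refine hb.exists_koszulDiff_eq hc f ?_ fun T => ?_
    · rw [← toSimplex_koszulDiff hc, h, toSimplex_zero]
    -- In positive degree constant terms vanish automatically: `T` is nonempty, so the augmentation
    -- kills its monomial.
    · by_cases hT : T.card = i + 1
      · rw [toSimplex, dif_pos hT, ← hb.augmentation_apply, map_mul, hb.augmentation_basis,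
          mul_zero]
        obtain ⟨k, hk⟩ : T.Nonempty := Finset.card_pos.1 (by omega)
        exact fun h0 => by simpa [indicatorExp, hk] using congrFun h0 k
      · rw [toSimplex_of_card_ne b f hT, map_zero]
  · rintro ⟨g, rfl⟩
    apply hb.toSimplex_injective
    rw [toSimplex_koszulDiff hc, toSimplex_koszulDiff hc, boundary_boundary, toSimplex_zero]

/-- The empty face. -/
def Face.nil : Face n 0 := ⟨∅, rfl⟩

theorem Face.eq_nil (T : Face n 0) : T = Face.nil :=
  Subtype.ext (Finset.card_eq_zero.1 T.2)

/-- The augmentation of the Koszul complex. -/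
noncomputable def koszulAugmentation (ε : A →ₐ[K] K) :
    (Face n 0 →₀ A) →ₛₗ[(ε : A →+* K)] K where
  toFun f := ε (f Face.nil)
  map_add' f g := by simp
  map_smul' a f := by simp

theorem IsMonomialBasis.koszulAugmentation_exact (hb : IsMonomialBasis b)
    (hx : ∀ i, hb.augmentation (x i) = 0)
    (hc : ∀ s T, s ∉ T → c s T • (x s * b (indicatorExp T)) = b (indicatorExp (insert s T))) :
    Function.Exact (koszulDiff x c 0) (koszulAugmentation hb.augmentation) := by
  intro f
  constructor
  · intro h
    refine hb.exists_koszulDiff_eq hc f ?_ fun T => ?_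
    · funext T
      refine Finset.sum_eq_zero fun s _ => ?_
      rw [toSimplex_of_card_ne, smul_zero]
      exact (Finset.card_pos.2 (Finset.insert_nonempty s T)).ne'
    · by_cases hT : T.card = 0
      · rw [toSimplex, dif_pos hT, ← hb.augmentation_apply, map_mul, Face.eq_nil ⟨T, hT⟩]
        exact mul_eq_zero_of_left h _
      · rw [toSimplex_of_card_ne b f hT, map_zero]
  · rintro ⟨g, rfl⟩
    change hb.augmentation (koszulDiff x c 0 g Face.nil) = 0
    rw [koszulDiff_apply, map_sum]
    refine Finset.sum_eq_zero fun s _ => ?_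
    rw [map_mul, map_zsmul, map_smul, hx, smul_zero, smul_zero, mul_zero]

theorem koszulDiff_mem_freeComponent (x : Fin n → A) (c : Fin n → Finset (Fin n) → K) (i j : ℕ)
    (f : Face n (i + 1) →₀ A) (hf : f ∈ freeComponent K x (Face n (i + 1)) (i + 1) j) :
    koszulDiff x c i f ∈ freeComponent K x (Face n i) i j := by
  simp only [freeComponent, Set.mem_ofPred_eq] at hf ⊢
  by_cases h : i + 1 ≤ j
  · rw [if_pos h] at hf
    rw [if_pos (by omega)]
    intro T
    rw [koszulDiff_apply]
    refine Submodule.sum_mem _ fun s _ => ?_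
    -- The coefficient `x s` supplies the one degree by which the generators differ.
    rw [component, show j - i = j - (i + 1) + 1 by omega, pow_succ]
    refine Submodule.mul_mem_mul (hf _) (zsmul_mem ?_ _)
    exact Submodule.smul_mem _ _ (Submodule.subset_span ⟨_, rfl⟩)
  · rw [if_neg h] at hf
    subst hf
    rw [map_zero]
    split_ifs
    · exact fun T => Submodule.zero_mem _
    · rfl

theorem component_le_ker (ε : A →ₐ[K] K) (hx : ∀ i, ε (x i) = 0) {j : ℕ} (hj : 0 < j) :
    component K x j ≤ LinearMap.ker ε.toLinearMap := by
  obtain ⟨k, rfl⟩ := Nat.exists_eq_succ_of_ne_zero hj.ne'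
  rw [component, pow_succ, Submodule.mul_le]
  intro a _ a' ha'
  have h : Submodule.span K (Set.range x) ≤ LinearMap.ker ε.toLinearMap := by
    rw [Submodule.span_le]
    rintro _ ⟨i, rfl⟩
    exact hx i
  have h' : ε a' = 0 := h ha'
  simp [h']

theorem IsMonomialBasis.nonempty_linearFreeResolution (hb : IsMonomialBasis b)
    (hx : ∀ i, b (Pi.single i 1) = x i) : Nonempty (LinearFreeResolution K x) := by
  -- The twisting scalar is the inverse of the one produced by multiplying the variable into the
  -- monomial; keeping `s ∉ T` inside the existential makes `c` a total function.
  have hc : ∀ s T, ∃ c : K, s ∉ T →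
      c • (x s * b (indicatorExp T)) = b (indicatorExp (insert s T)) := by
    intro s T
    obtain ⟨c, hc, he⟩ := hb.mul (Pi.single s 1) (indicatorExp T)
    refine ⟨c⁻¹, fun hs => ?_⟩
    rw [← hx, he, indicatorExp_insert hs, inv_smul_smul₀ hc]
  choose c hc using hc
  have hε : ∀ i, hb.augmentation (x i) = 0 := fun i => by
    rw [← hx]
    exact hb.augmentation_basis (by simp)
  exact ⟨{
    ε := hb.augmentation
    ε_var := hε
    S := Face n
    d := koszulDiff x c
    d_degree := koszulDiff_mem_freeComponent x c
    π := koszulAugmentation hb.augmentation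
    π_degree := fun j hj f hf => by
      simp only [freeComponent, Set.mem_ofPred_eq, if_pos (Nat.zero_le j)] at hf
      exact component_le_ker hb.augmentation hε hj (hf Face.nil)
    π_surjective := fun k => ⟨Finsupp.single Face.nil (algebraMap K A k), by
      change hb.augmentation (Finsupp.single Face.nil (algebraMap K A k) Face.nil) = k
      rw [Finsupp.single_eq_same, AlgHom.commutes, Algebra.algebraMap_self_apply]⟩
    exact_zero := hb.koszulAugmentation_exact hε hc
    exact_succ := hb.koszulDiff_exact hc }⟩

end KoszulComplex

end SkewPBW

theorem corollary3p13 (K : Type*) [Field K] (A : Type*) [Ring A] [Algebra K A]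
    (n : ℕ) (x : Fin n → A)
    (hA : SkewPBW.IsSemiCommutative (algebraMap K A) x) :
    SkewPBW.IsQuantumAffineSpace K x ∧ SkewPBW.IsHomogeneousKoszul K x := by
  obtain ⟨b, hb⟩ := hA.quasiCommutative.exists_basis
  obtain ⟨q, hq1, hq, hx⟩ := hA.quasiCommutative.exists_quantum_parameters
  have hq0 : ∀ i j, q i j ≠ 0 := fun i j => left_ne_zero_of_mul_eq_one (hq i j)
  have hspace : SkewPBW.IsQuantumAffineSpace K x :=
    ⟨q, hq1, hq, SkewPBW.isPresentedBy_quantumRelations K x q hq0 hx b hb⟩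
  have hmono : SkewPBW.IsMonomialBasis b :=
    ⟨(hb 0).trans (SkewPBW.stdMonomial_zero x), fun α β => by
      simpa only [hb] using SkewPBW.stdMonomial_mul K x (fun i j => ⟨q i j, hq0 i j, hx i j⟩) α β⟩
  exact ⟨hspace, SkewPBW.isHomogeneousPreKoszul_of_isQuantumAffineSpace K hspace,
    hmono.nonempty_linearFreeResolution fun i => (hb _).trans (SkewPBW.stdMonomial_single x i)⟩
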